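/- Let $D$ be a connected (finite-dimensional) complex manifold and $\mathcal V\to D$ a Hermitian holomorphic vector bundle of finite rank. Let a Lie group $H$ act on $\mathcal V\to D$ by automorphisms: every $h\in H$ acts by biholomorphic maps $x\mapsto h\cdot x$ of $D$ and $L_h$ of the total space $\mathcal V$, where $L_h$ covers $x\mapsto h\cdot x$ and restricts to unitary linear maps $\mathcal V_x\to\mathcal V_{h\cdot x}$ for all $x\in D$. Let $\mathcal O(D,\mathcal V)$ be the space of global holomorphic sections with the topology of uniform convergence on compact sets, on which $H$ acts by $(h\cdot s)(x)=L_h\,s(h^{-1}\cdot x)$. A unitary (strongly continuous) representation $\pi$ of $H$ on a Hilbert space $\mathcal H$ is said to be realized in $\mathcal O(D,\mathcal V)$ if there is an injective continuous linear $H$-intertwining map $\mathcal H\to\mathcal O(D,\mathcal V)$. Suppose that $H$ acts transitively on $D$ and that, for some $x\in D$, the isotropy subgroup $H_x=\{h\in H: h\cdot x=x\}$ acts irreducibly on $\mathcal V_x$. Then: 1. $H_x$ acts irreducibly on $\mathcal V_x$ for every $x\in D$. 2. Up to unitary equivalence, there is at most one nonzero unitary representation of $H$ that is realized in $\mathcal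 O(D,\mathcal V)$. 3. Every nonzero unitary representation of $H$ that is realized in $\mathcal O(D,\mathcal V)$ is irreducible. -/

import Mathlib

open scoped Manifold ContDiff

noncomputable section

/-! ## Hermitian holomorphic vector bundles

A holomorphic vector bundle `V → D` over a complex manifold `D` modelled on the finite-dimensional
space `EB`, with typical fiber `F`, is given by Mathlib's classes `FiberBundle F V`,
`VectorBundle ℂ F V` and `ContMDiffVectorBundle ω F V 𝓘(ℂ, EB)`: over the field `ℂ`, regularity `ω`
means that the transition functions are complex analytic, that is, holomorphic. -/

/-- The fiberwise inner products of `V → D` form a Hermitian metric: the inner product of any two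
vectors of a local frame is a real-smooth function on the base. -/
class IsHermitianBundle (EB : Type*) [NormedAddCommGroup EB] [NormedSpace ℂ EB]
    {D : Type*} [TopologicalSpace D] [ChartedSpace EB D]
    (F : Type*) [NormedAddCommGroup F] [NormedSpace ℂ F]
    (V : D → Type*) [TopologicalSpace (Bundle.TotalSpace F V)]
    [∀ x, NormedAddCommGroup (V x)] [∀ x, InnerProductSpace ℂ (V x)]
    [FiberBundle F V] [VectorBundle ℂ F V] : Prop where
  contMDiffOn_inner : ∀ (e : Bundle.Trivialization F
      (Bundle.TotalSpace.proj : Bundle.TotalSpace F V → D))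
    [MemTrivializationAtlas e] (v w : F),
    ContMDiffOn 𝓘(ℝ, EB) 𝓘(ℝ, ℂ) ∞ (fun x ↦ (inner ℂ (e.symm x v) (e.symm x w) : ℂ)) e.baseSet

/-- The identification of two fibers over equal points. -/
def fiberCast {D : Type*} {V : D → Type*}
    [∀ x, NormedAddCommGroup (V x)] [∀ x, InnerProductSpace ℂ (V x)]
    {x y : D} (h : x = y) : V x ≃ₗᵢ[ℂ] V y :=
  h ▸ LinearIsometryEquiv.refl ℂ (V x)

theorem mk_fiberCast {D F : Type*} {V : D → Type*}
    [∀ x, NormedAddCommGroup (V x)] [∀ x, InnerProductSpace ℂ (V x)]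
    {x y : D} (h : x = y) (v : V x) :
    (⟨y, fiberCast h v⟩ : Bundle.TotalSpace F V) = ⟨x, v⟩ := by
  subst h; rfl

section Bundle

variable (EB : Type*) [NormedAddCommGroup EB] [NormedSpace ℂ EB]
  {D : Type*} [TopologicalSpace D] [ChartedSpace EB D]
  (F : Type*) [NormedAddCommGroup F] [NormedSpace ℂ F]
  (V : D → Type*) [TopologicalSpace (Bundle.TotalSpace F V)]
  [∀ x, NormedAddCommGroup (V x)] [∀ x, InnerProductSpace ℂ (V x)]
  [FiberBundle F V] [VectorBundle ℂ F V]

/-- The space `𝒪(D, V)` of global holomorphic sections of `V → D`. -/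
abbrev HolSection := ContMDiffSection 𝓘(ℂ, EB) F ω V

variable {EB F V}

/-- The supremum over `K` of the fiberwise distances of two sections. -/
abbrev HolSection.supEDist (K : Set D) : PseudoEMetricSpace (HolSection EB F V) where
  edist s t := ⨆ x ∈ K, edist (s x) (t x)
  edist_self s := by simp
  edist_comm s t := by simp_rw [edist_comm]
  edist_triangle s t u := by
    refine iSup₂_le fun x hx ↦ (edist_triangle (s x) (t x) (u x)).trans ?_
    exact add_le_add (le_iSup₂_of_le x hx le_rfl) (le_iSup₂_of_le x hx le_rfl)

/-- The topology on `𝒪(D, V)` of uniform convergence on compact subsets of `D`. -/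
instance HolSection.instTopologicalSpace : TopologicalSpace (HolSection EB F V) :=
  ⨅ (K : Set D) (_ : IsCompact K), (HolSection.supEDist K).toUniformSpace.toTopologicalSpace

variable (EB F V)

/-- An action of the group `H` by automorphisms on the Hermitian holomorphic vector bundle
`V → D`, lifting a given action of `H` on `D`: linear isometries `L h x : V x → V (h • x)` which
form an action on the total space, such that each `h` acts holomorphically on the base and on the
total space (hence biholomorphically, the inverse being the action of `h⁻¹`). -/
structure BundleAction (H : Type*) [Group H] [MulAction H D] where
  L : ∀ (h : H) (x : D), V x ≃ₗᵢ[ℂ] V (h • x)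
  L_one : ∀ (x : D) (v : V x),
    (⟨(1 : H) • x, L 1 x v⟩ : Bundle.TotalSpace F V) = ⟨x, v⟩
  L_mul : ∀ (g h : H) (x : D) (v : V x),
    (⟨(g * h) • x, L (g * h) x v⟩ : Bundle.TotalSpace F V) = ⟨g • h • x, L g (h • x) (L h x v)⟩
  contMDiff_base : ∀ h : H, ContMDiff 𝓘(ℂ, EB) 𝓘(ℂ, EB) ω (fun x : D ↦ h • x)
  contMDiff_total : ∀ h : H,
    ContMDiff (𝓘(ℂ, EB).prod 𝓘(ℂ, F)) (𝓘(ℂ, EB).prod 𝓘(ℂ, F)) ω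
      (fun p : Bundle.TotalSpace F V ↦ (⟨h • p.1, L h p.1 p.2⟩ : Bundle.TotalSpace F V))

namespace BundleAction

variable {EB F V} {H : Type*} [Group H] [MulAction H D] (A : BundleAction EB F V H)

/-- The isotropy representation of `H_x` on the fiber `V x`. -/
def isotropyRep (x : D) : Representation ℂ (MulAction.stabilizer H x) (V x) where
  toFun g := ((A.L g x).trans (fiberCast (V := V) g.2)).toLinearEquiv.toLinearMap
  map_one' := by
    ext v
    have h := (mk_fiberCast (F := F) (V := V) (x := (1 : H) • x) (one_smul H x)
      (A.L 1 x v)).trans (A.L_one x v)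
    exact Bundle.TotalSpace.mk_inj.1 h
  map_mul' g h := by
    ext v
    have e : ∀ {y z : D} (hyz : y = z) (w : V y),
        (⟨g.1 • z, A.L g.1 z (fiberCast hyz w)⟩ : Bundle.TotalSpace F V)
          = ⟨g.1 • y, A.L g.1 y w⟩ := by
      rintro y z rfl w; rfl
    refine Bundle.TotalSpace.mk_inj (F := F).1 ?_
    refine (mk_fiberCast _ _).trans ((A.L_mul _ _ _ _).trans ?_)
    exact ((mk_fiberCast _ _).trans (e h.2 _)).symm

/-- The translate `x ↦ L_h (s (h⁻¹ • x))` of a holomorphic section `s`. -/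
def translate (h : H) (s : HolSection EB F V) : HolSection EB F V where
  toFun x := fiberCast (V := V) (smul_inv_smul h x) (A.L h (h⁻¹ • x) (s (h⁻¹ • x)))
  contMDiff_toFun := by
    have key := (A.contMDiff_total h).comp (s.contMDiff.comp (A.contMDiff_base h⁻¹))
    refine key.congr fun x ↦ ?_
    exact mk_fiberCast _ _

theorem translate_smul (h : H) (s : HolSection EB F V) (x : D) :
    A.translate h s (h • x) = A.L h x (s x) := by
  refine Bundle.TotalSpace.mk_inj (F := F).1 ((mk_fiberCast _ _).trans ?_)
  have e : ∀ {y : D} (_ : y = x), (⟨h • y, A.L h y (s y)⟩ : Bundle.TotalSpace F V)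
      = ⟨h • x, A.L h x (s x)⟩ := by
    rintro y rfl; rfl
  exact e (inv_smul_smul h x)

/-- The representation of `H` on `𝒪(D, V)` by `(h • s)(x) = L_h (s (h⁻¹ • x))`. -/
def sectionRep : Representation ℂ H (HolSection EB F V) where
  toFun h :=
    { toFun := A.translate h
      map_add' := fun s t ↦ by
        ext x
        simp [translate]
      map_smul' := fun c s ↦ by
        ext x
        simp [translate] }
  map_one' := by
    ext s x
    have h := A.translate_smul 1 s x
    refine Bundle.TotalSpace.mk_inj (F := F).1 ((mk_fiberCast _ _).trans ?_)
    rw [A.L_one]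
    have e : ∀ {y : D} (_ : y = x), (⟨y, s y⟩ : Bundle.TotalSpace F V) = ⟨x, s x⟩ := by
      rintro y rfl; rfl
    exact e (by simp)
  map_mul' g h := by
    ext s x
    obtain ⟨y, rfl⟩ : ∃ y : D, g • h • y = x := ⟨h⁻¹ • g⁻¹ • x, by simp⟩
    change A.translate (g * h) s (g • h • y) = A.translate g (A.translate h s) (g • h • y)
    rw [A.translate_smul, A.translate_smul]
    have e : ∀ {z : D} (hz : (g * h) • y = z),
        A.translate (g * h) s z = fiberCast (V := V) hz (A.translate (g * h) s ((g * h) • y)) := by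
      rintro z rfl; rfl
    rw [e (mul_smul g h y), A.translate_smul]
    refine Bundle.TotalSpace.mk_inj (F := F).1 ((mk_fiberCast _ _).trans ?_)
    exact A.L_mul _ _ _ _

end BundleAction

end Bundle

/-! ## Unitary representations -/

/-- A unitary representation of a topological group `H` on a Hilbert space: a strongly continuous
homomorphism to the unitary group. -/
structure UnitaryRep (H : Type*) [Group H] [TopologicalSpace H]
    (𝓗 : Type*) [NormedAddCommGroup 𝓗] [InnerProductSpace ℂ 𝓗] where
  toHom : H →* (𝓗 ≃ₗᵢ[ℂ] 𝓗)
  continuous_apply : ∀ v : 𝓗, Continuous fun h : H ↦ toHom h v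

namespace UnitaryRep

variable {H : Type*} [Group H] [TopologicalSpace H]
  {𝓗 : Type*} [NormedAddCommGroup 𝓗] [InnerProductSpace ℂ 𝓗]
  {𝓗' : Type*} [NormedAddCommGroup 𝓗'] [InnerProductSpace ℂ 𝓗']

/-- Irreducibility: the space is nonzero and has no closed invariant subspaces besides the two
trivial ones. -/
def IsIrreducible (π : UnitaryRep H 𝓗) : Prop :=
  Nontrivial 𝓗 ∧ ∀ W : Submodule ℂ 𝓗, IsClosed (W : Set 𝓗) →
    (∀ (h : H), ∀ v ∈ W, π.toHom h v ∈ W) → W = ⊥ ∨ W = ⊤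

/-- Unitary equivalence of unitary representations. -/
def UnitarilyEquivalent (π : UnitaryRep H 𝓗) (π' : UnitaryRep H 𝓗') : Prop :=
  ∃ U : 𝓗 ≃ₗᵢ[ℂ] 𝓗', ∀ (h : H) (v : 𝓗), U (π.toHom h v) = π'.toHom h (U v)

/-- `π` is realized in `𝒪(D, V)`: there is an injective continuous linear `H`-intertwining map
from its Hilbert space into `𝒪(D, V)`. -/
def IsRealizedIn {EB : Type*} [NormedAddCommGroup EB] [NormedSpace ℂ EB]
    {D : Type*} [TopologicalSpace D] [ChartedSpace EB D]
    {F : Type*} [NormedAddCommGroup F] [NormedSpace ℂ F]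
    {V : D → Type*} [TopologicalSpace (Bundle.TotalSpace F V)]
    [∀ x, NormedAddCommGroup (V x)] [∀ x, InnerProductSpace ℂ (V x)]
    [FiberBundle F V] [VectorBundle ℂ F V] [MulAction H D]
    (π : UnitaryRep H 𝓗) (A : BundleAction EB F V H) : Prop :=
  ∃ ι : 𝓗 →L[ℂ] HolSection EB F V, Function.Injective ι ∧
    ∀ (h : H) (v : 𝓗), ι (π.toHom h v) = A.sectionRep h (ι v)

end UnitaryRep

end

noncomputable section

open Metric Set Filter Topology ComplexConjugate

/-! The proof is by reproducing kernels. Point evaluations on a realized Hilbert space are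
continuous, so the Riesz theorem gives vectors `kernelVec ι x α` representing `v ↦ α (ι v x)`. They
span a dense subspace because `ι` is injective, and `H` maps them to one another (`map_kernelVec`).

The kernel on the diagonal is an endomorphism of each fiber commuting with the isotropy group. By
Schur's lemma and transitivity it is one scalar on all fibers, positive since the space is nonzero
(`exists_diagonalKernel_eq_smul`). The kernel is holomorphic in one variable and antiholomorphic in
the other, hence determined on connected `D` by its diagonal (`kernel_eq_of_diagonal`). So the
kernels of two realizations differ by a factor `r > 0` (`exists_inner_kernelVec_eq_mul`).

Rescaling by `√r` equates the Gram matrices of the two families of kernel vectors, which yields an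
intertwining unitary. For irreducibility, compare the kernel of the whole space with that of a
nonzero closed invariant `W`: proportionality puts all kernel vectors in `W`, so `W = ⊤`. -/

/-! ### Holomorphy and sesquiholomorphic kernels in one variable -/

/-- Banach–Steinhaus bounds `Φ` locally, Cauchy estimates uniform in `v` make it Lipschitz in
operator norm, and it then equals its own Cauchy integral. -/
theorem differentiableOn_clm_of_apply {E G : Type*} [NormedAddCommGroup E] [NormedSpace ℂ E]
    [CompleteSpace E] [NormedAddCommGroup G] [NormedSpace ℂ G] [CompleteSpace G]
    {Φ : ℂ → E →L[ℂ] G} {S : Set ℂ} (hS : IsOpen S)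
    (h : ∀ v, DifferentiableOn ℂ (fun z ↦ Φ z v) S) : DifferentiableOn ℂ Φ S := by
  intro z₀ hz₀
  obtain ⟨r, hr, hrS⟩ := nhds_basis_closedBall.mem_iff.1 (hS.mem_nhds hz₀)
  obtain ⟨C, hC⟩ : ∃ C, ∀ z : closedBall z₀ r, ‖Φ z‖ ≤ C := by
    refine banach_steinhaus fun v ↦ ?_
    obtain ⟨C, hC⟩ := (isCompact_closedBall z₀ r).exists_bound_of_continuousOn
      ((h v).continuousOn.mono hrS)
    exact ⟨C, fun z ↦ hC z z.2⟩
  have hC0 : 0 ≤ C := (norm_nonneg _).trans (hC ⟨z₀, mem_closedBall_self hr.le⟩)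
  have hr2 : 0 < r / 2 := by positivity
  have hsub : ∀ z ∈ closedBall z₀ (r / 2), closedBall z (r / 2) ⊆ closedBall z₀ r := by
    intro z hz
    refine closedBall_subset_closedBall' ?_
    have := mem_closedBall.1 hz
    linarith
  have hsub0 : closedBall z₀ (r / 2) ⊆ S :=
    (closedBall_subset_closedBall (by linarith)).trans hrS
  have hlip : LipschitzOnWith (Real.toNNReal (C / (r / 2))) Φ (closedBall z₀ (r / 2)) := by
    refine LipschitzOnWith.of_dist_le_mul fun z hz w hw ↦ ?_
    rw [dist_eq_norm, dist_eq_norm, Real.coe_toNNReal _ (by positivity)]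
    refine ContinuousLinearMap.opNorm_le_bound _ (by positivity) fun v ↦ ?_
    have hd : ∀ x ∈ closedBall z₀ (r / 2), ‖deriv (fun z ↦ Φ z v) x‖ ≤ C * ‖v‖ / (r / 2) := by
      intro x hx
      refine Complex.norm_deriv_le_of_forall_mem_sphere_norm_le hr2 ?_ fun y hy ↦ ?_
      · refine (DifferentiableOn.diffContOnCl ?_)
        rw [closure_ball _ hr2.ne']
        exact (h v).mono ((hsub x hx).trans hrS)
      · exact (Φ y).le_of_opNorm_le (hC ⟨y, hsub x hx (sphere_subset_closedBall hy)⟩) v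
    have := (convex_closedBall z₀ (r / 2)).norm_image_sub_le_of_norm_deriv_le
      (fun x hx ↦ (h v).differentiableAt (hS.mem_nhds (hsub0 hx))) hd hw hz
    calc ‖(Φ z - Φ w) v‖ = ‖Φ z v - Φ w v‖ := rfl
      _ ≤ _ := this
      _ = _ := by ring
  have hci : CircleIntegrable Φ z₀ (r / 2) :=
    (hlip.continuousOn.mono sphere_subset_closedBall).circleIntegrable hr2.le
  lift r / 2 to NNReal using hr2.le with R
  have key := (hasFPowerSeriesOn_cauchy_integral hci hr2).analyticAt.differentiableAt
  refine (key.congr_of_eventuallyEq ?_).differentiableWithinAt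
  filter_upwards [ball_mem_nhds z₀ hr2] with w hw
  ext v
  have hdc : DiffContOnCl ℂ (fun z ↦ Φ z v) (ball z₀ R) := by
    refine DifferentiableOn.diffContOnCl ?_
    rw [closure_ball _ hr2.ne']
    exact (h v).mono hsub0
  rw [← hdc.two_pi_i_inv_smul_circleIntegral_sub_inv_smul hw, smul_apply]
  congr 1
  have hint : CircleIntegrable (fun z ↦ (z - w)⁻¹ • Φ z) z₀ R := by
    refine ContinuousOn.circleIntegrable hr2.le (ContinuousOn.fun_smul ?_
      (hlip.continuousOn.mono sphere_subset_closedBall))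
    refine ContinuousOn.inv₀ (by fun_prop) fun z hz hzw ↦ ?_
    rw [sub_eq_zero] at hzw
    subst hzw
    exact (mem_ball.1 hw).ne (mem_sphere.1 hz)
  rw [circleIntegral, circleIntegral, ContinuousLinearMap.intervalIntegral_apply hint.out]
  rfl

/-- Composing a holomorphic map with a conjugate-linear map and with the conjugation of its argument
gives a holomorphic map. -/
theorem DifferentiableAt.conjLinear_comp_conj {E G : Type*} [NormedAddCommGroup E]
    [NormedSpace ℂ E] [NormedAddCommGroup G] [NormedSpace ℂ G] (J : E →SL[starRingEnd ℂ] G)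
    {f : ℂ → E} {s : ℂ} (hf : DifferentiableAt ℂ f (conj s)) :
    DifferentiableAt ℂ (fun t ↦ J (f (conj t))) s := by
  refine HasDerivAt.differentiableAt (f' := J (deriv f (conj s))) ?_
  have := hasDerivAt_iff_tendsto_slope.1 hf.hasDerivAt
  rw [hasDerivAt_iff_tendsto_slope]
  have hc : Tendsto (conj : ℂ → ℂ) (𝓝[≠] s) (𝓝[≠] (conj s)) :=
    (Complex.continuous_conj.tendsto s).inf
      (tendsto_principal_principal.2 fun t ht h ↦ ht ((starRingEnd ℂ).injective h))
  refine ((J.continuous.tendsto _).comp (this.comp hc)).congr fun t ↦ ?_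
  simp [slope_def_module, map_smulₛₗ]

/-- A sesquiholomorphic kernel which vanishes on the diagonal vanishes identically. -/
theorem inner_eq_of_inner_conj_eq {𝓗₁ 𝓗₂ : Type*}
    [NormedAddCommGroup 𝓗₁] [InnerProductSpace ℂ 𝓗₁] [CompleteSpace 𝓗₁]
    [NormedAddCommGroup 𝓗₂] [InnerProductSpace ℂ 𝓗₂] [CompleteSpace 𝓗₂]
    {S : Set ℂ} (hS : IsOpen S) (hconv : Convex ℝ S)
    {Φ₁ Ψ₁ : ℂ → 𝓗₁ →L[ℂ] ℂ} {Φ₂ Ψ₂ : ℂ → 𝓗₂ →L[ℂ] ℂ}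
    (hΦ₁ : ∀ v, DifferentiableOn ℂ (fun z ↦ Φ₁ z v) S)
    (hΨ₁ : ∀ v, DifferentiableOn ℂ (fun z ↦ Ψ₁ z v) S)
    (hΦ₂ : ∀ v, DifferentiableOn ℂ (fun z ↦ Φ₂ z v) S)
    (hΨ₂ : ∀ v, DifferentiableOn ℂ (fun z ↦ Ψ₂ z v) S) {c : ℂ}
    (hdiag : ∀ z ∈ S, Φ₁ z ((InnerProductSpace.toDual ℂ 𝓗₁).symm (Ψ₁ z)) =
      c * Φ₂ z ((InnerProductSpace.toDual ℂ 𝓗₂).symm (Ψ₂ z)))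
    {z : ℂ} (hz : z ∈ S) (hz' : conj z ∈ S) :
    Φ₁ z ((InnerProductSpace.toDual ℂ 𝓗₁).symm (Ψ₁ (conj z))) =
      c * Φ₂ z ((InnerProductSpace.toDual ℂ 𝓗₂).symm (Ψ₂ (conj z))) := by
  set J₁ := (InnerProductSpace.toDual ℂ 𝓗₁).symm
  set J₂ := (InnerProductSpace.toDual ℂ 𝓗₂).symm
  set T : Set ℂ := S ∩ conj ⁻¹' S with hT
  have hTo : IsOpen T := hS.inter (hS.preimage Complex.continuous_conj)
  have hTc : Convex ℝ T :=
    hconv.inter (hconv.linear_preimage Complex.conjAe.toLinearMap)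
  -- The Riesz map is conjugate-linear, so conjugating the argument of `Ψ` makes `g` holomorphic; at
  -- real `t` it reduces to the diagonal.
  set g : ℂ → ℂ := fun t ↦ Φ₁ t (J₁ (Ψ₁ (conj t))) - c * Φ₂ t (J₂ (Ψ₂ (conj t)))
  have hg : DifferentiableOn ℂ g T := by
    intro t ht
    have d1 := (differentiableOn_clm_of_apply hS hΦ₁).differentiableAt (hS.mem_nhds ht.1)
    have d2 := (differentiableOn_clm_of_apply hS hΦ₂).differentiableAt (hS.mem_nhds ht.1)
    have d3 := ((differentiableOn_clm_of_apply hS hΨ₁).differentiableAt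
      (hS.mem_nhds ht.2)).conjLinear_comp_conj
        (J₁.toContinuousLinearEquiv : _ →SL[starRingEnd ℂ] 𝓗₁)
    have d4 := ((differentiableOn_clm_of_apply hS hΨ₂).differentiableAt
      (hS.mem_nhds ht.2)).conjLinear_comp_conj
        (J₂.toContinuousLinearEquiv : _ →SL[starRingEnd ℂ] 𝓗₂)
    exact ((d1.clm_apply d3).sub ((d2.clm_apply d4).const_mul c)).differentiableWithinAt
  -- `T` is convex and stable under conjugation, so it contains this real point, where real zeros of
  -- `g` accumulate.
  set m : ℂ := (z.re : ℂ)
  have hm : m ∈ T := by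
    have : m = midpoint ℝ z (conj z) := by
      rw [midpoint_eq_smul_add, Complex.add_conj]
      simp [m]
    rw [this]
    exact hTc.midpoint_mem ⟨hz, hz'⟩ ⟨hz', by simpa using hz⟩
  have hfreq : ∃ᶠ t in 𝓝[≠] m, g t = 0 := by
    have hmap : Tendsto (fun x : ℝ ↦ (x : ℂ)) (𝓝[≠] z.re) (𝓝[≠] m) :=
      (Complex.continuous_ofReal.tendsto _).inf
        (tendsto_principal_principal.2 fun t ht h ↦ ht (Complex.ofReal_injective h))
    refine hmap.frequently (Eventually.frequently ?_)
    filter_upwards [hmap.eventually (mem_nhdsWithin_of_mem_nhds (hTo.mem_nhds hm))] with x hx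
    have := hdiag x hx.1
    simp only [g, Complex.conj_ofReal, this, sub_self]
  have := (hg.analyticOnNhd hTo).eqOn_zero_of_preconnected_of_frequently_eq_zero
    hTc.isPreconnected hm hfreq ⟨hz, hz'⟩
  exact sub_eq_zero.1 this

/-! ### Total families in Hilbert spaces and their Gram matrices -/

theorem denseRange_linearCombination {ι 𝓗 : Type*} [NormedAddCommGroup 𝓗]
    [InnerProductSpace ℂ 𝓗] {u : ι → 𝓗}
    (hu : (Submodule.span ℂ (range u)).topologicalClosure = ⊤) :
    DenseRange (Finsupp.linearCombination ℂ u) := by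
  rw [← Finsupp.range_linearCombination] at hu
  exact (LinearMap.range (Finsupp.linearCombination ℂ u)).dense_iff_topologicalClosure_eq_top.2 hu

/-- Vectors with equal Gram matrices are matched by a surjective isometry. -/
theorem exists_linearIsometryEquiv_of_inner_eq {ι : Type*} {𝓗₁ 𝓗₂ : Type*}
    [NormedAddCommGroup 𝓗₁] [InnerProductSpace ℂ 𝓗₁] [CompleteSpace 𝓗₁]
    [NormedAddCommGroup 𝓗₂] [InnerProductSpace ℂ 𝓗₂] [CompleteSpace 𝓗₂]
    {u : ι → 𝓗₁} {w : ι → 𝓗₂} (h : ∀ i j, inner ℂ (u i) (u j) = inner ℂ (w i) (w j))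
    (hu : (Submodule.span ℂ (range u)).topologicalClosure = ⊤)
    (hw : (Submodule.span ℂ (range w)).topologicalClosure = ⊤) :
    ∃ U : 𝓗₁ ≃ₗᵢ[ℂ] 𝓗₂, ∀ i, U (u i) = w i := by
  have hn : ∀ x : ι →₀ ℂ,
      ‖Finsupp.linearCombination ℂ w x‖ = ‖Finsupp.linearCombination ℂ u x‖ := by
    intro x
    rw [← sq_eq_sq₀ (norm_nonneg _) (norm_nonneg _)]
    have : (inner ℂ (Finsupp.linearCombination ℂ w x) (Finsupp.linearCombination ℂ w x) : ℂ) =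
        inner ℂ (Finsupp.linearCombination ℂ u x) (Finsupp.linearCombination ℂ u x) := by
      simp only [Finsupp.linearCombination_apply, Finsupp.sum, sum_inner, inner_sum,
        inner_smul_left, inner_smul_right, h]
    rw [inner_self_eq_norm_sq_to_K, inner_self_eq_norm_sq_to_K] at this
    exact_mod_cast this
  refine ⟨(LinearEquiv.refl ℂ (ι →₀ ℂ)).extendOfIsometry (Finsupp.linearCombination ℂ u)
    (Finsupp.linearCombination ℂ w) (denseRange_linearCombination hu)
    (denseRange_linearCombination hw) hn, fun i ↦ ?_⟩
  have := LinearEquiv.extendOfIsometry_eq (LinearEquiv.refl ℂ (ι →₀ ℂ))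
    (Finsupp.linearCombination ℂ u) (Finsupp.linearCombination ℂ w)
    (denseRange_linearCombination hu)
    (denseRange_linearCombination hw) hn
    (Finsupp.single i 1)
  simpa using this

/-! ### Hilbert spaces of sections and kernel vectors -/

section Sections

variable {EB : Type*} [NormedAddCommGroup EB] [NormedSpace ℂ EB]
  {D : Type*} [TopologicalSpace D] [ChartedSpace EB D]
  {F : Type*} [NormedAddCommGroup F] [NormedSpace ℂ F]
  {V : D → Type*} [TopologicalSpace (Bundle.TotalSpace F V)]
  [∀ x, NormedAddCommGroup (V x)] [∀ x, InnerProductSpace ℂ (V x)]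
  [FiberBundle F V] [VectorBundle ℂ F V]

/-- Singletons are compact, and evaluation at `x` is 1-Lipschitz for `supEDist {x}`. -/
theorem HolSection.continuous_eval (x : D) : Continuous fun s : HolSection EB F V ↦ s x := by
  have hle : (HolSection.instTopologicalSpace : TopologicalSpace (HolSection EB F V)) ≤
      (HolSection.supEDist {x}).toUniformSpace.toTopologicalSpace :=
    iInf₂_le (f := fun (K : Set D) (_ : IsCompact K) ↦
      (HolSection.supEDist (EB := EB) (F := F) (V := V) K).toUniformSpace.toTopologicalSpace)
      {x} isCompact_singleton
  refine continuous_le_dom hle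
    (@LipschitzWith.continuous _ _ (HolSection.supEDist {x}) _ 1 _ fun s t ↦ ?_)
  rw [ENNReal.coe_one, one_mul]
  exact le_iSup₂_of_le (f := fun y _ ↦ edist (s y) (t y)) x rfl le_rfl

variable {𝓗 : Type*} [NormedAddCommGroup 𝓗] [InnerProductSpace ℂ 𝓗]

/-- Evaluation at `x` of the sections in a Hilbert space of sections. -/
def evalCLM (ι : 𝓗 →L[ℂ] HolSection EB F V) (x : D) : 𝓗 →L[ℂ] V x where
  toFun v := ι v x
  map_add' v w := by simp
  map_smul' c v := by simp
  cont := (HolSection.continuous_eval x).comp ι.continuous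

@[simp]
theorem evalCLM_apply (ι : 𝓗 →L[ℂ] HolSection EB F V) (x : D) (v : 𝓗) :
    evalCLM ι x v = ι v x := rfl

/-- The vector of a Hilbert space of sections representing the functional `v ↦ α (ι v x)`. -/
def kernelVec [CompleteSpace 𝓗] (ι : 𝓗 →L[ℂ] HolSection EB F V) (x : D) (α : V x →L[ℂ] ℂ) : 𝓗 :=
  (InnerProductSpace.toDual ℂ 𝓗).symm (α ∘L evalCLM ι x)

@[simp]
theorem inner_kernelVec [CompleteSpace 𝓗] (ι : 𝓗 →L[ℂ] HolSection EB F V) (x : D)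
    (α : V x →L[ℂ] ℂ) (v : 𝓗) : inner ℂ (kernelVec ι x α) v = α (ι v x) := by
  simp [kernelVec]

/-! ### Identity theorem and determination of the kernel by its diagonal -/

section Manifold

variable [IsManifold 𝓘(ℂ, EB) ω D] [ContMDiffVectorBundle ω F V 𝓘(ℂ, EB)]

/-- Around every point there are a convex chart and a local frame in which all holomorphic sections
are analytic. -/
theorem exists_chart_trivialization (x₀ : D) :
    ∃ (B : Set EB) (ψ : EB → D) (U : Set D) (φ : D → EB)
      (e : Bundle.Trivialization F (Bundle.TotalSpace.proj : Bundle.TotalSpace F V → D))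
      (_ : MemTrivializationAtlas e),
      IsOpen B ∧ Convex ℝ B ∧ U ∈ 𝓝 x₀ ∧ MapsTo φ U B ∧ (∀ x ∈ U, ψ (φ x) = x) ∧
      ContinuousOn ψ B ∧ MapsTo ψ B e.baseSet ∧
      ∀ s : HolSection EB F V,
        AnalyticOnNhd ℂ (fun p ↦ e.continuousLinearMapAt ℂ (ψ p) (s (ψ p))) B := by
  set φ := extChartAt 𝓘(ℂ, EB) x₀
  set e := trivializationAt F V x₀
  have hN : φ.target ∩ φ.symm ⁻¹' e.baseSet ∈ 𝓝 (φ x₀) := by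
    refine inter_mem (extChartAt_target_mem_nhds x₀) ?_
    refine (continuousAt_extChartAt_symm (I := 𝓘(ℂ, EB)) x₀).preimage_mem_nhds ?_
    rw [extChartAt_to_inv]
    exact e.open_baseSet.mem_nhds (FiberBundle.mem_baseSet_trivializationAt' x₀)
  obtain ⟨r, hr, hrN⟩ := nhds_basis_ball.mem_iff.1 hN
  refine ⟨ball (φ x₀) r, φ.symm, φ.source ∩ φ ⁻¹' ball (φ x₀) r, φ, e, inferInstance, isOpen_ball,
    convex_ball _ _, ?_, fun x hx ↦ hx.2, fun x hx ↦ φ.left_inv hx.1, ?_,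
    fun p hp ↦ (hrN hp).2, fun s ↦ ?_⟩
  · exact inter_mem (extChartAt_source_mem_nhds x₀)
      ((continuousAt_extChartAt x₀).preimage_mem_nhds (isOpen_ball.mem_nhds (mem_ball_self hr)))
  · exact (continuousOn_extChartAt_symm x₀).mono fun p hp ↦ (hrN hp).1
  · have h1 : ContMDiffOn 𝓘(ℂ, EB) 𝓘(ℂ, F) ω (fun x ↦ (e ⟨x, s x⟩).2) e.baseSet :=
      e.contMDiffOn_section_baseSet_iff.1 s.contMDiff.contMDiffOn
    have h2 : ContMDiffOn 𝓘(ℂ, EB) 𝓘(ℂ, F) ω (fun p ↦ (e ⟨φ.symm p, s (φ.symm p)⟩).2)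
        (ball (φ x₀) r) :=
      h1.comp ((contMDiffOn_extChartAt_symm x₀).mono fun p hp ↦ (hrN hp).1)
        fun p hp ↦ (hrN hp).2
    rw [contMDiffOn_iff_contDiffOn, contDiffOn_omega_iff_analyticOn isOpen_ball.uniqueDiffOn,
      isOpen_ball.analyticOn_iff_analyticOnNhd] at h2
    refine h2.congr isOpen_ball fun p hp ↦ ?_
    rw [Bundle.Trivialization.continuousLinearMapAt_apply, Bundle.Trivialization.linearMapAt_apply,
      if_pos (show φ.symm p ∈ e.baseSet from (hrN hp).2)]

/-- The identity theorem for holomorphic sections. -/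
theorem HolSection.eq_zero_of_eventually [PreconnectedSpace D] {s : HolSection EB F V} {x₀ : D}
    (h : ∀ᶠ x in 𝓝 x₀, s x = 0) (x : D) : s x = 0 := by
  set W : Set D := {x | ∀ᶠ y in 𝓝 x, s y = 0}
  suffices W = univ from (this ▸ mem_univ x : x ∈ W).self_of_nhds
  refine IsClopen.eq_univ ⟨?_, isOpen_setOfPred_eventually_nhds⟩ ⟨x₀, h⟩
  refine closure_subset_iff_isClosed.1 fun z hz ↦ ?_
  obtain ⟨B, ψ, U, φ, e, _, hB, hBc, hU, hφ, hψφ, hψ, hψe, hs⟩ :=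
    exists_chart_trivialization (EB := EB) (F := F) (V := V) z
  -- The section vanishes near `y`, so its local expression vanishes near `φ y` and hence on all of
  -- the convex set `B`, which covers a neighborhood of `z`.
  obtain ⟨y, hyU, hyW⟩ := mem_closure_iff_nhds.1 hz U hU
  have hev : (fun p ↦ e.continuousLinearMapAt ℂ (ψ p) (s (ψ p))) =ᶠ[𝓝 (φ y)] 0 := by
    have hc : Tendsto ψ (𝓝 (φ y)) (𝓝 y) := by
      have := hψ.continuousAt (hB.mem_nhds (hφ hyU))
      rwa [ContinuousAt, hψφ y hyU] at this
    filter_upwards [hc.eventually hyW] with p hp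
    simp [hp]
  have hzero := (hs s).eqOn_zero_of_preconnected_of_eventuallyEq_zero hBc.isPreconnected
    (hφ hyU) hev
  filter_upwards [hU] with w hw
  have h0 := hzero (hφ hw)
  simp only [Pi.zero_apply] at h0
  have key : ∀ x ∈ e.baseSet, e.continuousLinearMapAt ℂ x (s x) = 0 → s x = 0 := fun x hx h ↦ by
    rw [← e.symmL_continuousLinearMapAt (R := ℂ) hx (s x), h, map_zero]
  rw [← hψφ w hw]
  exact key _ (hψe (hφ hw)) h0

variable [CompleteSpace 𝓗] {𝓗' : Type*} [NormedAddCommGroup 𝓗'] [InnerProductSpace ℂ 𝓗']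
  [CompleteSpace 𝓗']

/-- In a convex chart, two points lie on a complex line, on which `inner_eq_of_inner_conj_eq`
applies. -/
theorem eventually_kernel_eq_of_diagonal {ι : 𝓗 →L[ℂ] HolSection EB F V}
    {ι' : 𝓗' →L[ℂ] HolSection EB F V} {c : ℂ}
    (h : ∀ (x : D) (β : V x →L[ℂ] ℂ), ι (kernelVec ι x β) x = c • ι' (kernelVec ι' x β) x)
    (x₀ : D) : ∃ U ∈ 𝓝 x₀, ∀ x ∈ U, ∀ y ∈ U, ∀ β : V y →L[ℂ] ℂ,
      ι (kernelVec ι y β) x = c • ι' (kernelVec ι' y β) x := by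
  obtain ⟨B, ψ, U, φ, e, _, hB, hBc, hU, hφ, hψφ, -, hψe, hs⟩ :=
    exists_chart_trivialization (EB := EB) (F := F) (V := V) x₀
  refine ⟨U, hU, fun x hx y hy β ↦ ?_⟩
  have hxe : x ∈ e.baseSet := hψφ x hx ▸ hψe (hφ hx)
  have hye : y ∈ e.baseSet := hψφ y hy ▸ hψe (hφ hy)
  suffices ∀ ℓ : F →L[ℂ] ℂ, ℓ (e.continuousLinearMapAt ℂ x (ι (kernelVec ι y β) x)) =
      ℓ (e.continuousLinearMapAt ℂ x (c • ι' (kernelVec ι' y β) x)) by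
    have := (SeparatingDual.eq_iff_forall_dual_eq (R := ℂ)).2 this
    rw [← e.symmL_continuousLinearMapAt (R := ℂ) hxe (ι (kernelVec ι y β) x), this,
      e.symmL_continuousLinearMapAt (R := ℂ) hxe]
  intro ℓ
  -- In the local frame `β` has a constant coefficient `m`, so it extends to a family of functionals
  -- along the line.
  obtain ⟨m, rfl⟩ : ∃ m : F →L[ℂ] ℂ, β = m ∘L e.continuousLinearMapAt ℂ y :=
    ⟨β ∘L e.symmL ℂ y, by
      ext v
      rw [ContinuousLinearMap.comp_apply, ContinuousLinearMap.comp_apply,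
        e.symmL_continuousLinearMapAt (R := ℂ) hye]⟩
  -- The complex line through `φ x` and `φ y`, parametrized so that they sit at the conjugate
  -- parameters `I` and `-I`.
  set σ : ℂ → EB := fun t ↦
    (1 / 2 : ℂ) • (φ x + φ y) + t • ((-Complex.I / 2) • (φ x - φ y)) with hσ
  have hσI : σ Complex.I = φ x := by
    simp only [hσ, smul_smul]
    rw [show Complex.I * (-Complex.I / 2) = 1 / 2 by
      linear_combination (-1 / 2 : ℂ) * Complex.I_mul_I]
    module
  have hσI' : σ (conj Complex.I) = φ y := by
    simp only [hσ, smul_smul, Complex.conj_I]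
    rw [show -Complex.I * (-Complex.I / 2) = -(1 / 2) by
      linear_combination (1 / 2 : ℂ) * Complex.I_mul_I]
    module
  have hσd : Differentiable ℂ σ := by fun_prop
  have hσc : Convex ℝ (σ ⁻¹' B) := by
    refine (hBc.affine_preimage ((AffineMap.const ℝ ℂ ((1 / 2 : ℂ) • (φ x + φ y))) +
      ((LinearMap.toSpanSingleton ℂ EB ((-Complex.I / 2) • (φ x - φ y))).restrictScalars
        ℝ).toAffineMap))
  have hd : ∀ (n : F →L[ℂ] ℂ) (s : HolSection EB F V), DifferentiableOn ℂ
      (fun t ↦ n (e.continuousLinearMapAt ℂ (ψ (σ t)) (s (ψ (σ t))))) (σ ⁻¹' B) := fun n s ↦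
    n.differentiable.comp_differentiableOn
      ((hs s).differentiableOn.comp hσd.differentiableOn fun t ht ↦ ht)
  have key := inner_eq_of_inner_conj_eq (hB.preimage hσd.continuous) hσc
    (Φ₁ := fun t ↦ ℓ ∘L e.continuousLinearMapAt ℂ (ψ (σ t)) ∘L evalCLM ι (ψ (σ t)))
    (Ψ₁ := fun t ↦ (m ∘L e.continuousLinearMapAt ℂ (ψ (σ t))) ∘L evalCLM ι (ψ (σ t)))
    (Φ₂ := fun t ↦ ℓ ∘L e.continuousLinearMapAt ℂ (ψ (σ t)) ∘L evalCLM ι' (ψ (σ t)))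
    (Ψ₂ := fun t ↦ (m ∘L e.continuousLinearMapAt ℂ (ψ (σ t))) ∘L evalCLM ι' (ψ (σ t)))
    (fun v ↦ hd ℓ (ι v)) (fun v ↦ hd m (ι v)) (fun v ↦ hd ℓ (ι' v)) (fun v ↦ hd m (ι' v)) (c := c)
    (fun t _ ↦ by
      have := congrArg (fun v ↦ ℓ (e.continuousLinearMapAt ℂ (ψ (σ t)) v))
        (h (ψ (σ t)) (m ∘L e.continuousLinearMapAt ℂ (ψ (σ t))))
      rw [map_smul, map_smul, smul_eq_mul] at this
      exact this)
    (z := Complex.I) (by simpa only [mem_preimage, hσI] using hφ hx)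
    (by simpa only [mem_preimage, hσI'] using hφ hy)
  beta_reduce at key
  rw [hσI, hσI', hψφ x hx, hψφ y hy] at key
  rw [map_smul, map_smul, smul_eq_mul]
  exact key

/-- The identity theorem is used twice: first in `x` with `y` near `x₀`, then, after exchanging the
variables by Hermitian symmetry, in the other one. Since `c` is real, it survives the conjugation.
-/
theorem kernel_eq_of_diagonal [ConnectedSpace D] {ι : 𝓗 →L[ℂ] HolSection EB F V}
    {ι' : 𝓗' →L[ℂ] HolSection EB F V} {c : ℝ}
    (h : ∀ (x : D) (β : V x →L[ℂ] ℂ),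
      ι (kernelVec ι x β) x = (c : ℂ) • ι' (kernelVec ι' x β) x)
    (x y : D) (α : V x →L[ℂ] ℂ) (β : V y →L[ℂ] ℂ) :
    inner ℂ (kernelVec ι x α) (kernelVec ι y β) =
      c * inner ℂ (kernelVec ι' x α) (kernelVec ι' y β) := by
  obtain ⟨x₀⟩ := (inferInstance : Nonempty D)
  obtain ⟨U, hU, hUe⟩ := eventually_kernel_eq_of_diagonal h x₀
  have h1 : ∀ (x : D), ∀ y ∈ U, ∀ β : V y →L[ℂ] ℂ,
      ι (kernelVec ι y β) x = (c : ℂ) • ι' (kernelVec ι' y β) x := by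
    intro x y hy β
    have := HolSection.eq_zero_of_eventually (x₀ := x₀)
      (s := ι (kernelVec ι y β) - (c : ℂ) • ι' (kernelVec ι' y β)) (by
        filter_upwards [hU] with z hz
        simp [hUe z hz y hy β]) x
    simpa [sub_eq_zero] using this
  have h2 : ∀ y ∈ U, ∀ (β : V y →L[ℂ] ℂ), inner ℂ (kernelVec ι y β) (kernelVec ι x α) =
      c * inner ℂ (kernelVec ι' y β) (kernelVec ι' x α) := by
    intro y hy β
    rw [← inner_conj_symm, inner_kernelVec, h1 x y hy β, map_smul, ← inner_kernelVec, smul_eq_mul,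
      map_mul, inner_conj_symm, Complex.conj_ofReal]
  have h3 := HolSection.eq_zero_of_eventually (x₀ := x₀)
      (s := ι (kernelVec ι x α) - (c : ℂ) • ι' (kernelVec ι' x α)) (by
        filter_upwards [hU] with z hz
        refine (SeparatingDual.eq_zero_iff_forall_dual_eq_zero (R := ℂ) _).2 fun β ↦ ?_
        have := h2 z hz β
        simp only [inner_kernelVec] at this
        simp [this]) y
  have h4 : ι (kernelVec ι x α) y = (c : ℂ) • ι' (kernelVec ι' x α) y := by
    simpa [sub_eq_zero] using h3
  rw [← inner_conj_symm, inner_kernelVec, h4, map_smul, ← inner_kernelVec, smul_eq_mul,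
      map_mul, inner_conj_symm, Complex.conj_ofReal]

end Manifold

end Sections

/-! ### Invariant subspaces and Schur's lemma -/

theorem Representation.isIrreducible_iff_forall_submodule {k G W : Type*} [Monoid G] [Field k]
    [AddCommGroup W] [Module k W] (ρ : Representation k G W) :
    ρ.IsIrreducible ↔ Nontrivial W ∧ ∀ S : Submodule k W,
      (∀ g, ∀ v ∈ S, ρ g v ∈ S) → S = ⊥ ∨ S = ⊤ := by
  refine ⟨fun h ↦ ⟨?_, fun S hS ↦ ?_⟩, fun ⟨h, hS⟩ ↦ ?_⟩
  · by_contra hn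
    rw [not_nontrivial_iff_subsingleton] at hn
    refine bot_ne_top (α := Subrepresentation ρ) ?_
    exact Subrepresentation.toSubmodule_injective (Subsingleton.elim _ _)
  · refine (h.eq_bot_or_eq_top ⟨S, hS⟩).imp (fun e ↦ ?_) fun e ↦ ?_
    · exact congrArg Subrepresentation.toSubmodule e
    · exact congrArg Subrepresentation.toSubmodule e
  · refine { exists_pair_ne := ⟨⊥, ⊤, fun e ↦ ?_⟩, eq_bot_or_eq_top := fun S ↦ ?_ }
    · exact bot_ne_top (α := Submodule k W) (congrArg Subrepresentation.toSubmodule e)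
    · refine (hS S.toSubmodule S.apply_mem_toSubmodule).imp (fun e ↦ ?_) fun e ↦ ?_
      · exact Subrepresentation.toSubmodule_injective e
      · exact Subrepresentation.toSubmodule_injective e

/-- Schur's lemma for endomorphisms. -/
theorem Representation.IsIrreducible.exists_eq_smul {k G W : Type*} [Monoid G] [Field k]
    [IsAlgClosed k] [AddCommGroup W] [Module k W] [FiniteDimensional k W]
    {ρ : Representation k G W} (h : ρ.IsIrreducible) (T : W →ₗ[k] W)
    (hT : ∀ g v, T (ρ g v) = ρ g (T v)) : ∃ c : k, ∀ v, T v = c • v := by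
  obtain ⟨_, hS⟩ := ρ.isIrreducible_iff_forall_submodule.1 h
  obtain ⟨c, hc⟩ := Module.End.exists_eigenvalue T
  refine ⟨c, fun v ↦ ?_⟩
  rcases hS (Module.End.eigenspace T c) fun g v hv ↦ by
    rw [Module.End.mem_eigenspace_iff] at hv ⊢
    rw [hT, hv, map_smul] with e | e
  · exact absurd e hc
  · exact Module.End.mem_eigenspace_iff.1 (e ▸ Submodule.mem_top)

/-! ### Group action on kernel vectors -/

section Action

variable {EB : Type*} [NormedAddCommGroup EB] [NormedSpace ℂ EB]
  {D : Type*} [TopologicalSpace D] [ChartedSpace EB D]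
  {F : Type*} [NormedAddCommGroup F] [NormedSpace ℂ F]
  {V : D → Type*} [TopologicalSpace (Bundle.TotalSpace F V)]
  [∀ x, NormedAddCommGroup (V x)] [∀ x, InnerProductSpace ℂ (V x)]
  [FiberBundle F V] [VectorBundle ℂ F V]
  {H : Type*} [Group H] [MulAction H D] (A : BundleAction EB F V H)

variable (F) in
theorem VectorBundle.finiteDimensional_fiber [FiniteDimensional ℂ F] (x : D) :
    FiniteDimensional ℂ (V x) :=
  ((trivializationAt F V x).continuousLinearEquivAt ℂ x
    (FiberBundle.mem_baseSet_trivializationAt' x)).symm.toLinearEquiv.finiteDimensional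

namespace BundleAction

/-- The action of `g` as a map between the fibers over `x` and `y = g • x`. -/
def transport (g : H) {x y : D} (h : g • x = y) : V x ≃ₗᵢ[ℂ] V y :=
  (A.L g x).trans (fiberCast h)

theorem transport_mul {g k : H} {x y z : D} (h₁ : k • x = y) (h₂ : g • y = z)
    (h₃ : (g * k) • x = z) (v : V x) :
    A.transport (g * k) h₃ v = A.transport g h₂ (A.transport k h₁ v) := by
  subst h₁ h₂
  refine Bundle.TotalSpace.mk_inj (F := F).1 ((mk_fiberCast _ _).trans ?_)
  exact A.L_mul _ _ _ _

theorem transport_congr {g k : H} (e : g = k) {x y : D} (h : g • x = y) (h' : k • x = y) (v : V x) :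
    A.transport g h v = A.transport k h' v := by
  subst e; rfl

/-- An element `g` with `g • x = y` conjugates `H_x` into `H_y`, and its action on fibers
intertwines accordingly, so invariant subspaces pull back. -/
theorem isotropyRep_isIrreducible_of_isPretransitive [MulAction.IsPretransitive H D] {x : D}
    (hx : (A.isotropyRep x).IsIrreducible) (y : D) : (A.isotropyRep y).IsIrreducible := by
  obtain ⟨g, hg⟩ := MulAction.exists_smul_eq H x y
  rw [Representation.isIrreducible_iff_forall_submodule] at hx ⊢
  obtain ⟨hn, hx⟩ := hx
  set T := A.transport g hg
  refine ⟨T.symm.toEquiv.nontrivial, fun S hS ↦ ?_⟩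
  have hmem : ∀ k : MulAction.stabilizer H x,
      g * k.1 * g⁻¹ ∈ MulAction.stabilizer H y := fun k ↦ by
    have := k.2
    rw [MulAction.mem_stabilizer_iff] at this ⊢
    rw [← hg, mul_smul, inv_smul_smul, mul_smul, this]
  have hgy : ∀ k : MulAction.stabilizer H x, (g * k.1) • x = y := fun k ↦ by
    rw [mul_smul, show k.1 • x = x from k.2, hg]
  have hconj : ∀ (k : MulAction.stabilizer H x) (v : V x),
      T (A.isotropyRep x k v) = A.isotropyRep y ⟨_, hmem k⟩ (T v) := by
    intro k v
    refine (A.transport_mul (g := g) (k := k.1) k.2 hg (hgy k) v).symm.trans ?_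
    refine Eq.trans ?_ (A.transport_mul (g := g * k.1 * g⁻¹) (k := g) hg (hmem k)
      (by rw [inv_mul_cancel_right]; exact hgy k) v)
    exact A.transport_congr (inv_mul_cancel_right _ _).symm _ _ _
  have key := hx (S.comap T.toLinearEquiv.toLinearMap) fun k v hv ↦ by
    rw [Submodule.mem_comap] at hv ⊢
    change T (A.isotropyRep x k v) ∈ S
    rw [hconj]
    exact hS _ _ hv
  refine key.imp (fun e ↦ ?_) fun e ↦ ?_
  · refine (Submodule.eq_bot_iff _).2 fun v hv ↦ ?_
    have : T.symm v ∈ S.comap T.toLinearEquiv.toLinearMap := by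
      rw [Submodule.mem_comap]
      change T (T.symm v) ∈ S
      simpa using hv
    rw [e, Submodule.mem_bot] at this
    simpa using this
  · refine (Submodule.eq_top_iff').2 fun v ↦ ?_
    have : T.symm v ∈ S.comap T.toLinearEquiv.toLinearMap := e ▸ Submodule.mem_top
    rw [Submodule.mem_comap] at this
    change T (T.symm v) ∈ S at this
    simpa using this

end BundleAction

variable {𝓗 : Type*} [NormedAddCommGroup 𝓗] [InnerProductSpace ℂ 𝓗] [CompleteSpace 𝓗]

theorem kernelVec_add (ι : 𝓗 →L[ℂ] HolSection EB F V) (x : D) (α β : V x →L[ℂ] ℂ) :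
    kernelVec ι x (α + β) = kernelVec ι x α + kernelVec ι x β :=
  ext_inner_right ℂ fun v ↦ by simp [inner_add_left]

theorem kernelVec_smul (ι : 𝓗 →L[ℂ] HolSection EB F V) (x : D) (c : ℂ) (α : V x →L[ℂ] ℂ) :
    kernelVec ι x (c • α) = conj c • kernelVec ι x α :=
  ext_inner_right ℂ fun v ↦ by simp [inner_smul_left]

/-- A vector orthogonal to every kernel vector gives a section vanishing at every point. -/
theorem kernelVec_span_topologicalClosure {ι : 𝓗 →L[ℂ] HolSection EB F V}
    (hι : Function.Injective ι) :
    (Submodule.span ℂ (range fun p : Σ x, V x →L[ℂ] ℂ ↦ kernelVec ι p.1 p.2)).topologicalClosure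
      = ⊤ := by
  rw [Submodule.topologicalClosure_eq_top_iff, Submodule.eq_bot_iff]
  intro v hv
  refine hι ?_
  rw [map_zero]
  ext x
  refine (SeparatingDual.eq_zero_iff_forall_dual_eq_zero (R := ℂ) _).2 fun α ↦ ?_
  rw [← inner_kernelVec]
  exact (Submodule.mem_orthogonal _ _).1 hv _ (Submodule.subset_span ⟨⟨x, α⟩, rfl⟩)

/-- The value of the reproducing kernel at a point of the diagonal, as an endomorphism of the
fiber. -/
def diagonalKernel (ι : 𝓗 →L[ℂ] HolSection EB F V) (x : D) : V x →ₗ[ℂ] V x where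
  toFun w := ι (kernelVec ι x (innerSL ℂ w)) x
  map_add' w w' := by simp [kernelVec_add]
  map_smul' c w := by simp [map_smulₛₗ, kernelVec_smul]

-- Only the adjoint relation and the intertwining relation are required of `f`, so the results apply
-- equally to a representation and to its restriction to an invariant subspace.
variable {A} {f : H → 𝓗 → 𝓗} (hf : ∀ g v w, inner ℂ (f g v) w = inner ℂ v (f g⁻¹ w))
  {ι : 𝓗 →L[ℂ] HolSection EB F V} (hι : ∀ g v, ι (f g v) = A.sectionRep g (ι v))

omit [CompleteSpace 𝓗] in
include hι in
theorem intertwining_apply_smul (g : H) (v : 𝓗) (x : D) :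
    ι (f g v) (g • x) = A.L g x (ι v x) := by
  rw [hι]
  exact A.translate_smul g (ι v) x

include hf hι in
theorem map_kernelVec (g : H) (x : D) (α : V x →L[ℂ] ℂ) :
    f g (kernelVec ι x α) = kernelVec ι (g • x)
      (α ∘L ((A.L g x).symm.toContinuousLinearEquiv : V (g • x) →L[ℂ] V x)) := by
  refine ext_inner_right ℂ fun v ↦ ?_
  -- `f` is not assumed multiplicative; the cancellation takes place in `sectionRep`, after applying
  -- `ι`.
  have hv : ι (f g (f g⁻¹ v)) = ι v := by
    rw [hι, hι, ← Module.End.mul_apply, ← map_mul, mul_inv_cancel, map_one, Module.End.one_apply]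
  rw [hf, inner_kernelVec, inner_kernelVec, ← hv, intertwining_apply_smul hι]
  simp

-- Since the fiber maps are unitary, they carry the functional `⟨w, ·⟩` to `⟨L_g w, ·⟩`. At `y = x`
-- this is commutation with the isotropy representation.
include hf hι in
theorem diagonalKernel_transport {g : H} {x y : D} (h : g • x = y) (w : V x) :
    diagonalKernel ι y (A.transport g h w) = A.transport g h (diagonalKernel ι x w) := by
  subst h
  change ι (kernelVec ι (g • x) (innerSL ℂ (A.L g x w))) (g • x) =
    A.L g x (ι (kernelVec ι x (innerSL ℂ w)) x)
  rw [← intertwining_apply_smul hι, map_kernelVec hf hι]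
  congr 3
  ext v
  obtain ⟨v, rfl⟩ := (A.L g x).surjective v
  simp

include hf hι in
/-- On the diagonal, the reproducing kernel of an invariant Hilbert space of sections is a positive
constant. -/
theorem exists_diagonalKernel_eq_smul [FiniteDimensional ℂ F] [MulAction.IsPretransitive H D]
    {x₀ : D} (hirr : (A.isotropyRep x₀).IsIrreducible) (hinj : Function.Injective ι)
    [Nontrivial 𝓗] : ∃ c : ℝ, 0 < c ∧ ∀ x w, diagonalKernel ι x w = (c : ℂ) • w := by
  have := VectorBundle.finiteDimensional_fiber (V := V) F x₀
  obtain ⟨c, hc⟩ := hirr.exists_eq_smul (diagonalKernel ι x₀) fun g v ↦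
    diagonalKernel_transport hf hι g.2 v
  have hc' : ∀ x w, diagonalKernel ι x w = c • w := by
    intro x w
    obtain ⟨g, hg⟩ := MulAction.exists_smul_eq H x₀ x
    obtain ⟨w, rfl⟩ := (A.transport g hg).surjective w
    rw [diagonalKernel_transport hf hι, hc, map_smul]
  have hnorm : ∀ x (w : V x), ((‖kernelVec ι x (innerSL ℂ w)‖ : ℂ)) ^ 2 = c * (‖w‖ : ℂ) ^ 2 := by
    intro x w
    have h1 := inner_kernelVec ι x (innerSL ℂ w) (kernelVec ι x (innerSL ℂ w))
    rw [inner_self_eq_norm_sq_to_K, innerSL_apply_apply,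
      show ι (kernelVec ι x (innerSL ℂ w)) x = c • w from hc' x w, inner_smul_right,
      inner_self_eq_norm_sq_to_K] at h1
    exact h1
  obtain ⟨hn, -⟩ := (Representation.isIrreducible_iff_forall_submodule _).1 hirr
  obtain ⟨w, hw⟩ := exists_ne (0 : V x₀)
  have hw' : (‖w‖ : ℝ) ^ 2 ≠ 0 := by simpa using hw
  -- By `hnorm`, a single nonzero fiber vector shows that Schur's scalar is real and nonnegative.
  set r : ℝ := ‖kernelVec ι x₀ (innerSL ℂ w)‖ ^ 2 / ‖w‖ ^ 2 with hr
  have hcr : c = r := by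
    have := hnorm x₀ w
    rw [hr]
    push_cast
    rw [this, mul_div_cancel_right₀]
    exact_mod_cast hw'
  refine ⟨r, lt_of_le_of_ne (by positivity) fun h0 ↦ ?_, fun x w ↦ hcr ▸ hc' x w⟩
  -- Were the scalar zero, the kernel vector of `⟨ι v x, ·⟩` would vanish; pairing it with `v` gives
  -- `‖ι v x‖² = 0` for every `x`.
  obtain ⟨v, hv⟩ := exists_ne (0 : 𝓗)
  refine hv (hinj ?_)
  rw [map_zero]
  ext x
  rw [← h0] at hcr
  have h1 := hnorm x (ι v x)
  rw [hcr] at h1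
  have h2 : kernelVec ι x (innerSL ℂ (ι v x)) = 0 := by simpa using h1
  have h3 := inner_kernelVec ι x (innerSL ℂ (ι v x)) v
  rw [h2, inner_zero_left, innerSL_apply_apply] at h3
  exact inner_self_eq_zero.1 h3.symm

variable [IsManifold 𝓘(ℂ, EB) ω D] [ContMDiffVectorBundle ω F V 𝓘(ℂ, EB)]
  [FiniteDimensional ℂ F] [ConnectedSpace D]
  {𝓗' : Type*} [NormedAddCommGroup 𝓗'] [InnerProductSpace ℂ 𝓗'] [CompleteSpace 𝓗']
  {f' : H → 𝓗' → 𝓗'} (hf' : ∀ g v w, inner ℂ (f' g v) w = inner ℂ v (f' g⁻¹ w))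
  {ι' : 𝓗' →L[ℂ] HolSection EB F V} (hι' : ∀ g v, ι' (f' g v) = A.sectionRep g (ι' v))

include hf hι hf' hι' in
/-- Any two invariant Hilbert spaces of sections have proportional reproducing kernels. -/
theorem exists_inner_kernelVec_eq_mul [MulAction.IsPretransitive H D]
    {x₀ : D} (hirr : (A.isotropyRep x₀).IsIrreducible) [Nontrivial 𝓗] [Nontrivial 𝓗']
    (hinj : Function.Injective ι) (hinj' : Function.Injective ι') :
    ∃ r : ℝ, 0 < r ∧ ∀ (x y : D) (α : V x →L[ℂ] ℂ) (β : V y →L[ℂ] ℂ),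
      inner ℂ (kernelVec ι x α) (kernelVec ι y β) =
        r * inner ℂ (kernelVec ι' x α) (kernelVec ι' y β) := by
  obtain ⟨c, hc0, hc⟩ := exists_diagonalKernel_eq_smul hf hι hirr hinj
  obtain ⟨c', hc0', hc'⟩ := exists_diagonalKernel_eq_smul hf' hι' hirr hinj'
  refine ⟨c / c', by positivity, kernel_eq_of_diagonal fun x β ↦ ?_⟩
  have := VectorBundle.finiteDimensional_fiber (V := V) F x
  have := FiniteDimensional.complete ℂ (V x)
  -- `diagonalKernel` involves only functionals `⟨w, ·⟩`; on a finite-dimensional fiber these are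
  -- all of them.
  obtain ⟨w, rfl⟩ := (InnerProductSpace.toDual ℂ (V x)).surjective β
  have h1 : ι (kernelVec ι x (InnerProductSpace.toDual ℂ (V x) w)) x = (c : ℂ) • w := hc x w
  have h2 : ι' (kernelVec ι' x (InnerProductSpace.toDual ℂ (V x) w)) x = (c' : ℂ) • w := hc' x w
  have : (c' : ℂ) ≠ 0 := by exact_mod_cast hc0'.ne'
  rw [h1, h2, smul_smul, Complex.ofReal_div, div_mul_cancel₀ _ this]

end Action

/-! ### Uniqueness and irreducibility -/

theorem UnitaryRep.inner_toHom {H 𝓗 : Type*} [Group H] [TopologicalSpace H]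
    [NormedAddCommGroup 𝓗] [InnerProductSpace ℂ 𝓗] (π : UnitaryRep H 𝓗) (g : H) (v w : 𝓗) :
    inner ℂ (π.toHom g v) w = inner ℂ v (π.toHom g⁻¹ w) := by
  have h : π.toHom g (π.toHom g⁻¹ w) = w := by
    change (π.toHom g * π.toHom g⁻¹) w = w
    rw [← map_mul, mul_inv_cancel, map_one]
    rfl
  rw [← (π.toHom g).inner_map_map v, h]

end

theorem proposition2p5
    -- the connected complex manifold `D`
    {EB : Type*} [NormedAddCommGroup EB] [NormedSpace ℂ EB] [FiniteDimensional ℂ EB]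
    {D : Type*} [TopologicalSpace D] [T2Space D] [ConnectedSpace D]
    [ChartedSpace EB D] [IsManifold 𝓘(ℂ, EB) ω D]
    -- the Hermitian holomorphic vector bundle `V → D`
    {F : Type*} [NormedAddCommGroup F] [NormedSpace ℂ F] [FiniteDimensional ℂ F]
    {V : D → Type*} [TopologicalSpace (Bundle.TotalSpace F V)]
    [∀ x, NormedAddCommGroup (V x)] [∀ x, InnerProductSpace ℂ (V x)]
    [FiberBundle F V] [VectorBundle ℂ F V] [ContMDiffVectorBundle ω F V 𝓘(ℂ, EB)]
    [IsHermitianBundle EB F V]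
    -- the Lie group `H`, acting on `V → D` by automorphisms
    {EH : Type*} [NormedAddCommGroup EH] [NormedSpace ℝ EH] [FiniteDimensional ℝ EH]
    {H : Type*} [TopologicalSpace H] [ChartedSpace EH H] [Group H] [LieGroup 𝓘(ℝ, EH) ∞ H]
    [MulAction H D] (A : BundleAction EB F V H)
    (htrans : MulAction.IsPretransitive H D)
    (hirr : ∃ x : D, (A.isotropyRep x).IsIrreducible) :
    (∀ x : D, (A.isotropyRep x).IsIrreducible) ∧
    (∀ (𝓗₁ : Type*) [NormedAddCommGroup 𝓗₁] [InnerProductSpace ℂ 𝓗₁] [CompleteSpace 𝓗₁]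
      (𝓗₂ : Type*) [NormedAddCommGroup 𝓗₂] [InnerProductSpace ℂ 𝓗₂] [CompleteSpace 𝓗₂]
      (π₁ : UnitaryRep H 𝓗₁) (π₂ : UnitaryRep H 𝓗₂), Nontrivial 𝓗₁ → Nontrivial 𝓗₂ →
      π₁.IsRealizedIn A → π₂.IsRealizedIn A → π₁.UnitarilyEquivalent π₂) ∧
    (∀ (𝓗 : Type*) [NormedAddCommGroup 𝓗] [InnerProductSpace ℂ 𝓗] [CompleteSpace 𝓗]
      (π : UnitaryRep H 𝓗), Nontrivial 𝓗 → π.IsRealizedIn A → π.IsIrreducible) := by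
  obtain ⟨x₀, hx₀⟩ := hirr
  refine ⟨A.isotropyRep_isIrreducible_of_isPretransitive hx₀, ?_, ?_⟩
  · intro 𝓗₁ _ _ _ 𝓗₂ _ _ _ π₁ π₂ _ _ ⟨ι₁, hinj₁, hι₁⟩ ⟨ι₂, hinj₂, hι₂⟩
    obtain ⟨r, hr, hk⟩ := exists_inner_kernelVec_eq_mul (f := fun g ↦ π₁.toHom g)
      (f' := fun g ↦ π₂.toHom g) π₁.inner_toHom hι₁ π₂.inner_toHom hι₂ hx₀ hinj₁ hinj₂
    have hs : ((√r : ℝ) : ℂ) * (√r : ℝ) = r := by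
      rw [← Complex.ofReal_mul, Real.mul_self_sqrt hr.le]
    have hs0 : ((√r : ℝ) : ℂ) ≠ 0 := by
      exact_mod_cast (Real.sqrt_pos.2 hr).ne'
    have hd₁ := kernelVec_span_topologicalClosure hinj₁
    obtain ⟨U, hU⟩ := exists_linearIsometryEquiv_of_inner_eq
      (u := fun p : Σ x, V x →L[ℂ] ℂ ↦ kernelVec ι₁ p.1 p.2)
      -- The factor `√r` enters each inner product twice, which absorbs the ratio `r` of the two
      -- kernels.
      (w := fun p ↦ ((√r : ℝ) : ℂ) • kernelVec ι₂ p.1 p.2)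
      (fun p q ↦ by
        rw [hk, inner_smul_left, inner_smul_right, Complex.conj_ofReal, ← mul_assoc, hs])
      hd₁ (by
        rw [← kernelVec_span_topologicalClosure hinj₂]
        congr 1
        have := Submodule.span_smul_eq_of_isUnit
          (Set.range fun p : Σ x, V x →L[ℂ] ℂ ↦ kernelVec ι₂ p.1 p.2) _ hs0.isUnit
        rw [← this]
        congr 1
        exact Set.range_smul _ _)
    refine ⟨U, fun g v ↦ ?_⟩
    -- Both sides are continuous and agree on kernel vectors: `g` acts on the index `(x, α)` by the
    -- same rule in both spaces, and `U` preserves the index.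
    have hext : ((U.toContinuousLinearEquiv : 𝓗₁ →L[ℂ] 𝓗₂) ∘L
          ((π₁.toHom g).toContinuousLinearEquiv : 𝓗₁ →L[ℂ] 𝓗₁)) =
        (((π₂.toHom g).toContinuousLinearEquiv : 𝓗₂ →L[ℂ] 𝓗₂) ∘L
          (U.toContinuousLinearEquiv : 𝓗₁ →L[ℂ] 𝓗₂)) := by
      refine ContinuousLinearMap.ext_on
        (Submodule.dense_iff_topologicalClosure_eq_top.2 hd₁) ?_
      rintro _ ⟨⟨x, α⟩, rfl⟩
      have h1 := map_kernelVec (f := fun g ↦ π₁.toHom g) π₁.inner_toHom hι₁ g x α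
      have h2 := map_kernelVec (f := fun g ↦ π₂.toHom g) π₂.inner_toHom hι₂ g x α
      have e1 := hU ⟨x, α⟩
      have e2 := hU ⟨g • x,
        α ∘L ((A.L g x).symm.toContinuousLinearEquiv : V (g • x) →L[ℂ] V x)⟩
      change U (π₁.toHom g (kernelVec ι₁ x α)) = π₂.toHom g (U (kernelVec ι₁ x α))
      beta_reduce at h1 h2 e1 e2
      rw [e1, map_smul, h1, h2, e2]
    exact congrArg (fun T : 𝓗₁ →L[ℂ] 𝓗₂ ↦ T v) hext
  · intro 𝓗 _ _ _ π hn ⟨ι, hinj, hι⟩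
    refine ⟨hn, fun W hW hinv ↦ or_iff_not_imp_left.2 fun hbot ↦ ?_⟩
    have : CompleteSpace W := hW.completeSpace_coe
    have : Nontrivial W := Submodule.nontrivial_iff_ne_bot.2 hbot
    -- The closed subspace `W` is itself an invariant Hilbert space of sections, embedded by the
    -- restriction of `ι`.
    obtain ⟨r, hr, hk⟩ := exists_inner_kernelVec_eq_mul (f := fun g ↦ π.toHom g)
      (f' := fun g (v : W) ↦ (⟨π.toHom g v, hinv g v v.2⟩ : W)) (ι' := ι.comp W.subtypeL)
      π.inner_toHom hι (fun g v w ↦ π.inner_toHom g v w) (fun g v ↦ hι g v) hx₀ hinj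
      (hinj.comp Subtype.val_injective)
    have hmem : ∀ (y : D) (β : V y →L[ℂ] ℂ), kernelVec ι y β ∈ W := by
      intro y β
      -- Tested at each point `x` against each functional `α`, this equality of sections is exactly
      -- `hk`.
      suffices kernelVec ι y β = (r : ℂ) • ((kernelVec (ι.comp W.subtypeL) y β : W) : 𝓗) from
        this ▸ W.smul_mem _ (Subtype.property _)
      refine hinj ?_
      ext x
      refine (SeparatingDual.eq_iff_forall_dual_eq (R := ℂ)).2 fun α ↦ ?_
      have := hk x y α β
      rw [inner_kernelVec, inner_kernelVec] at this
      rw [this, map_smul, ContMDiffSection.coe_smul, Pi.smul_apply, map_smul, smul_eq_mul]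
      rfl
    rw [← hW.submodule_topologicalClosure_eq, eq_top_iff,
      ← kernelVec_span_topologicalClosure hinj]
    refine Submodule.topologicalClosure_mono (Submodule.span_le.2 ?_)
    rintro _ ⟨p, rfl⟩
    exact hmem _ _
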